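/- For a group $X$, let $\sigma(X)$ denote the least positive integer $m$ such that $X$ is the union of $m$ proper subgroups (with $\sigma(X)=\infty$ if there is no such $m$). A group $X$ is called a primitive $n$-sum group if $\sigma(X)=n$ and $\sigma(X/N)\neq n$ for every nontrivial normal subgroup $N$ of $X$. Let $\Phi(G)$, $Z(G)$ and $\operatorname{Inn}(G)$ denote the Frattini subgroup, the centre and the group of inner automorphisms of $G$. Let $G$ be a finite soluble group with a non-normal abelian maximal subgroup of index $\sigma(G)-1$, where $\sigma(G)$ is finite. Then $\Phi(G)\leq Z(G)$, $G/\Phi(G)\cong \operatorname{Inn}(G)\times Z(G)/\Phi(G)$, and $\operatorname{Inn}(G)$ is a primitive $\sigma(G)$-sum group. -/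

import Mathlib

/-- The covering number `σ(G)`: the least number of proper subgroups of `G` whose union is `G`.
It is `⊤` if `G` is not a union of proper subgroups (for instance if `G` is cyclic). -/
noncomputable def coveringNumber (G : Type*) [Group G] : ℕ∞ :=
  sInf {n : ℕ∞ | ∃ S : Set (Subgroup G),
    (∀ H ∈ S, H ≠ ⊤) ∧ (∀ g : G, ∃ H ∈ S, g ∈ H) ∧ S.encard = n}

/-- `G` is a primitive `n`-sum group: `σ(G) = n`, and no quotient of `G` by a nontrivial normal
subgroup has covering number `n`. -/
def IsPrimitiveSumGroup (n : ℕ) (G : Type*) [Group G] : Prop :=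
  coveringNumber G = n ∧
    ∀ (N : Subgroup G) [N.Normal], N ≠ ⊥ → coveringNumber (G ⧸ N) ≠ n

/-- The group `Inn(G)` of inner automorphisms of `G`, as a subgroup of `Aut(G)`. -/
def innerAut (G : Type*) [Group G] : Subgroup (MulAut G) :=
  (MulAut.conj : G →* MulAut G).range

/-! ### Non-normal abelian maximal subgroups -/

section MaximalSubgroups

variable {G : Type*} [Group G] {M : Subgroup G}

/-! The centre `Z` is exactly the core of `M`: the centraliser of a normal subgroup inside `M` is
normal and contains `M`, so it is `G`. Hence `Φ(G) ≤ Z`, and a suitable normal supplement of `Z`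
splits `G/Φ(G)`. In `Inn(G) ≅ G/Z` the image of `M` is abelian, maximal and core-free. Solubility
provides an abelian normal complement `A`, of order `n - 1`, on which it acts without fixed points.
As in a Frobenius group, `A` and the conjugates of the complement cover, so `σ(Inn(G)) ≤ n`;
coverings pull back to `G`, giving equality. By Schur's lemma the complement is cyclic, hence so are
all proper quotients of `Inn(G)`, and these have no covering. -/

theorem IsCoatom.sup_eq_top_of_not_le {α : Type*} [SemilatticeSup α] [OrderTop α] {a b : α}
    (ha : IsCoatom a) (h : ¬ b ≤ a) : b ⊔ a = ⊤ :=
  ha.2 _ (lt_of_le_of_ne le_sup_right fun e => h (e ▸ le_sup_left))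

/-- A subgroup centralised by a supplement of the centre of `G` is normal. -/
theorem Subgroup.normal_of_center_sup_eq_top {H : Subgroup G} (h : center G ⊔ H = ⊤) :
    H.Normal where
  conj_mem k hk g := by
    obtain ⟨z, hz, x, hx, rfl⟩ := mem_sup_of_normal_left.1 (h ▸ mem_top g)
    have e : z * x * k * (z * x)⁻¹ = x * k * x⁻¹ := by
      have := mem_center_iff.1 hz (x * k * x⁻¹)
      calc z * x * k * (z * x)⁻¹ = z * (x * k * x⁻¹) * z⁻¹ := by group
        _ = x * k * x⁻¹ := by rw [← this]; group
    exact e ▸ H.mul_mem (H.mul_mem hx hk) (H.inv_mem hx)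

theorem IsCoatom.center_le (hM : IsCoatom M) (hn : ¬ M.Normal) : Subgroup.center G ≤ M := by
  by_contra h
  exact hn (Subgroup.normal_of_center_sup_eq_top (hM.sup_eq_top_of_not_le h))

/-- The core of a non-normal abelian maximal subgroup is central. -/
theorem IsCoatom.normal_le_center (hM : IsCoatom M) (hn : ¬ M.Normal)
    (hc : IsMulCommutative M) {K : Subgroup G} [K.Normal] (hK : K ≤ M) :
    K ≤ Subgroup.center G := by
  have hle : M ≤ Subgroup.centralizer (K : Set G) := fun m hm =>
    Subgroup.mem_centralizer_iff.2 fun k hk =>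
      congrArg Subtype.val (isMulCommutative_iff.1 hc ⟨k, hK hk⟩ ⟨m, hm⟩)
  have htop : Subgroup.centralizer (K : Set G) = ⊤ := by
    refine hM.2 _ (lt_of_le_of_ne hle fun e => hn ?_)
    rw [e]; infer_instance
  intro k hk
  refine Subgroup.mem_center_iff.2 fun g => ?_
  exact (Subgroup.mem_centralizer_iff.1 (htop ▸ Subgroup.mem_top g) k hk).symm

end MaximalSubgroups

/-! ### Supplements of the centre -/

section CentralSupplement

variable {G : Type*} [Group G]

open Subgroup

/-- If the Frattini subgroup is central, the centre has a normal supplement meeting it in the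
Frattini subgroup. -/
theorem exists_normal_center_sup_eq_top_inf_eq_frattini [Finite G]
    (hΦ : frattini G ≤ center G) :
    ∃ H : Subgroup G, H.Normal ∧ center G ⊔ H = ⊤ ∧ center G ⊓ H = frattini G := by
  obtain ⟨H, hH⟩ := (Set.toFinite {H : Subgroup G | center G ⊔ H = ⊤}).exists_minimal
    ⟨⊤, sup_top_eq _⟩
  have hsup : center G ⊔ H = ⊤ := hH.prop
  have hinf : center G ⊓ H ≤ frattini G := by
    refine le_iInf₂ fun L hL => ?_
    -- Dedekind's law: if the maximal subgroup `L` misses part of `Z ∩ H`, then `L ∩ H` still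
    -- supplements `Z`, against minimality of `H`.
    by_contra hle
    have : H.Normal := normal_of_center_sup_eq_top hsup
    have htop := hL.sup_eq_top_of_not_le hle
    have hmem : center G ⊔ (L ⊓ H) = ⊤ := by
      refine top_le_iff.1 (hsup ▸ sup_le le_sup_left fun h hh => ?_)
      obtain ⟨k, hk, l, hl, rfl⟩ := mem_sup_of_normal_left.1 (htop ▸ mem_top h)
      have hlH : l ∈ H := by simpa using H.mul_mem (H.inv_mem hk.2) hh
      exact mul_mem_sup hk.1 ⟨hl, hlH⟩
    exact hle (inf_le_right.trans ((hH.le_of_le hmem inf_le_right).trans inf_le_left))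
  have hsup' : center G ⊔ (frattini G ⊔ H) = ⊤ :=
    top_le_iff.1 (hsup ▸ sup_le_sup_left le_sup_right _)
  refine ⟨frattini G ⊔ H, normal_of_center_sup_eq_top hsup', hsup',
    le_antisymm ?_ (le_inf hΦ le_sup_left)⟩
  rintro x ⟨hxZ, hx⟩
  obtain ⟨f, hf, h, hh, rfl⟩ := mem_sup_of_normal_left.1 hx
  have hhZ : h ∈ center G := by simpa using mul_mem (inv_mem (hΦ hf)) hxZ
  exact mul_mem hf (hinf ⟨hhZ, hh⟩)

end CentralSupplement

/-! ### Splitting off the inner automorphism group -/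

section ProductDecomposition

variable {G : Type*} [Group G]

open Subgroup

theorem ker_conj_rangeRestrict :
    (MulAut.conj : G →* MulAut G).rangeRestrict.ker = center G := by
  ext g
  simp only [MonoidHom.mem_ker, mem_center_iff, Subtype.ext_iff, MonoidHom.coe_rangeRestrict,
    OneMemClass.coe_one, MulEquiv.ext_iff, MulAut.conj_apply, MulAut.one_apply]
  exact forall_congr' fun x => ⟨fun h => (mul_inv_eq_iff_eq_mul.1 h).symm,
    fun h => mul_inv_eq_iff_eq_mul.2 h.symm⟩

/-- A normal supplement of the centre gives a direct product decomposition of the quotient by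
the intersection. -/
theorem nonempty_quotient_mulEquiv_innerAut_prod {H F : Subgroup G} [H.Normal] [F.Normal]
    (hsup : center G ⊔ H = ⊤) (hinf : center G ⊓ H = F) :
    Nonempty (G ⧸ F ≃* innerAut G × (center G ⧸ F.subgroupOf (center G))) := by
  let f : G →* innerAut G × (G ⧸ H) :=
    (MulAut.conj : G →* MulAut G).rangeRestrict.prod (QuotientGroup.mk' H)
  have hker : f.ker = F := by
    rw [← hinf, ← ker_conj_rangeRestrict]
    ext g
    rw [mem_inf, MonoidHom.mem_ker, MonoidHom.mem_ker, ← QuotientGroup.eq_one_iff (N := H)]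
    exact Prod.ext_iff
  have hf : Function.Surjective f := by
    rintro ⟨⟨_, x, rfl⟩, q⟩
    obtain ⟨y, rfl⟩ := QuotientGroup.mk_surjective q
    obtain ⟨z, hz, h, hh, e⟩ := mem_sup_of_normal_left.1 (hsup ▸ mem_top (y * x⁻¹))
    -- The central factor `z` corrects the class modulo `H` without changing conjugation by `x`.
    refine ⟨z * x, Prod.ext ?_ ?_⟩
    · have hz' : z ∈ (MulAut.conj : G →* MulAut G).rangeRestrict.ker :=
        ker_conj_rangeRestrict (G := G) ▸ hz
      change (MulAut.conj : G →* MulAut G).rangeRestrict (z * x) = MulAut.conj.rangeRestrict x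
      rw [map_mul, MonoidHom.mem_ker.1 hz', one_mul]
    · change ((z * x : G) : G ⧸ H) = y
      have hy : y = z * h * x := by rw [e]; group
      rw [QuotientGroup.eq, hy]
      have := ‹H.Normal›.conj_mem h hh x⁻¹
      convert this using 1
      group
  let p : center G →* G ⧸ H := (QuotientGroup.mk' H).comp (center G).subtype
  have hpker : p.ker = F.subgroupOf (center G) := by
    ext z
    simp [p, MonoidHom.mem_ker, mem_subgroupOf, ← hinf]
  have hp : Function.Surjective p := by
    intro q
    obtain ⟨y, rfl⟩ := QuotientGroup.mk_surjective q
    obtain ⟨z, hz, h, hh, rfl⟩ := mem_sup_of_normal_left.1 (hsup ▸ mem_top y)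
    refine ⟨⟨z, hz⟩, ?_⟩
    change (z : G ⧸ H) = _
    rw [QuotientGroup.eq]
    simpa using hh
  exact ⟨((QuotientGroup.quotientMulEquivOfEq hker.symm).trans
    (QuotientGroup.quotientKerEquivOfSurjective f hf)).trans
    ((MulEquiv.refl _).prodCongr ((QuotientGroup.quotientMulEquivOfEq hpker.symm).trans
      (QuotientGroup.quotientKerEquivOfSurjective p hp)).symm)⟩

end ProductDecomposition

/-! ### Coverings under quotients -/

section CoveringNumber

variable {G : Type*} [Group G]

theorem coveringNumber_le_of_surjective {Q : Type*} [Group Q] {f : G →* Q}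
    (hf : Function.Surjective f) : coveringNumber G ≤ coveringNumber Q := by
  refine le_sInf ?_
  rintro _ ⟨S, hS, hcov, rfl⟩
  refine le_trans (b := (Subgroup.comap f '' S).encard)
    (sInf_le ⟨_, ?_, fun g => ?_, rfl⟩) (Set.encard_image_le _ _)
  · rintro _ ⟨H, hH, rfl⟩ h
    refine hS H hH (Subgroup.comap_injective hf ?_)
    rw [h, Subgroup.comap_top]
  · obtain ⟨H, hH, hg⟩ := hcov (f g)
    exact ⟨_, ⟨H, hH, rfl⟩, hg⟩

theorem coveringNumber_eq_top_of_isCyclic [IsCyclic G] : coveringNumber G = ⊤ := by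
  refine sInf_eq_top.2 ?_
  rintro _ ⟨S, hS, hcov, -⟩
  obtain ⟨g, hg⟩ := IsCyclic.exists_generator (α := G)
  obtain ⟨H, hH, hgH⟩ := hcov g
  refine absurd (top_le_iff.1 fun x _ => ?_) (hS H hH)
  exact (Subgroup.zpowers_le.2 hgH) (hg x)

end CoveringNumber

/-! ### Groups with a core-free abelian maximal subgroup -/

section Primitive

variable {Q : Type*} [Group Q] {M A : Subgroup Q}

open Subgroup

/-- The last nontrivial term of the derived series works. -/
theorem exists_normal_isMulCommutative_ne_bot (Q : Type*) [Group Q] [Group.IsSolvable Q]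
    [Nontrivial Q] : ∃ A : Subgroup Q, A.Normal ∧ IsMulCommutative A ∧ A ≠ ⊥ := by
  classical
  have hs := (Group.isSolvable_def Q).1 ‹_›
  obtain ⟨k, hk⟩ : ∃ k, Nat.find hs = k + 1 := Nat.exists_eq_succ_of_ne_zero fun h0 => by
    have := Nat.find_spec hs
    rw [h0, derivedSeries_zero] at this
    exact top_ne_bot this
  refine ⟨derivedSeries Q k, derivedSeries_normal Q k, isMulCommutative_iff.2 fun a b => ?_,
    Nat.find_min hs (by omega)⟩
  have h := Nat.find_spec hs
  rw [hk, derivedSeries_succ] at h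
  refine Subtype.ext (commutatorElement_eq_one_iff_mul_comm.1 ?_)
  exact mem_bot.1 (h ▸ commutator_mem_commutator a.2 b.2)

/-- A subgroup of an abelian normal subgroup `A` that is normalised by a supplement of `A` is
normal. -/
theorem Subgroup.normal_of_le_isMulCommutative [A.Normal] (hA : IsMulCommutative A)
    (hsup : A ⊔ M = ⊤) {K : Subgroup Q} (hKA : K ≤ A)
    (hK : ∀ m ∈ M, ∀ k ∈ K, m * k * m⁻¹ ∈ K) : K.Normal where
  conj_mem k hk g := by
    obtain ⟨a, ha, m, hm, rfl⟩ := mem_sup_of_normal_left.1 (hsup ▸ mem_top g)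
    have h := hK m hm k hk
    have hc : a * (m * k * m⁻¹) = m * k * m⁻¹ * a :=
      congrArg Subtype.val (isMulCommutative_iff.1 hA ⟨a, ha⟩ ⟨_, hKA h⟩)
    have e : a * m * k * (a * m)⁻¹ = m * k * m⁻¹ :=
      calc a * m * k * (a * m)⁻¹ = a * (m * k * m⁻¹) * a⁻¹ := by group
        _ = m * k * m⁻¹ := by rw [hc]; group
    exact e ▸ h

/-- An abelian normal subgroup of a group with a core-free maximal subgroup is a
complement of it. -/
theorem sup_eq_top_and_inf_eq_bot_of_coreFree (hM : IsCoatom M)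
    (hcore : ∀ K : Subgroup Q, K.Normal → K ≤ M → K = ⊥) [A.Normal] (hA : IsMulCommutative A)
    (hAne : A ≠ ⊥) : A ⊔ M = ⊤ ∧ A ⊓ M = ⊥ := by
  have hsup := hM.sup_eq_top_of_not_le fun h => hAne (hcore A ‹_› h)
  refine ⟨hsup, hcore _ (normal_of_le_isMulCommutative hA hsup inf_le_left ?_) inf_le_right⟩
  rintro m hm k ⟨hkA, hkM⟩
  exact ⟨‹A.Normal›.conj_mem k hkA m, M.mul_mem (M.mul_mem hm hkM) (M.inv_mem hm)⟩

/-- Nontrivial elements of the point stabiliser `M` act without fixed points on `A`. -/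
theorem eq_one_of_commute_of_coreFree (hM : IsCoatom M) (hMc : IsMulCommutative M)
    (hcore : ∀ K : Subgroup Q, K.Normal → K ≤ M → K = ⊥) (hinf : A ⊓ M = ⊥)
    {m a : Q} (hm : m ∈ M) (ha : a ∈ A) (h : a * m = m * a) (hm1 : m ≠ 1) : a = 1 := by
  have hle : M ≤ centralizer {m} := fun x hx => mem_centralizer_singleton_iff.2
    (congrArg Subtype.val (isMulCommutative_iff.1 hMc ⟨x, hx⟩ ⟨m, hm⟩))
  have haC : a ∈ centralizer {m} := mem_centralizer_singleton_iff.2 h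
  -- By maximality the centraliser of `m` is `M` or `Q`; in the latter case `m` generates a normal
  -- subgroup inside `M`.
  rcases hle.eq_or_lt with e | hlt
  · exact mem_bot.1 (hinf ▸ ⟨ha, e ▸ haC⟩)
  · have htop := hM.2 _ hlt
    have hz : zpowers m ≤ center Q := zpowers_le.2 <| mem_center_iff.2 fun g =>
      mem_centralizer_singleton_iff.1 (htop ▸ mem_top g)
    have hn : (zpowers m).Normal := ⟨fun n hn g => by
      rwa [mem_center_iff.1 (hz hn) g, mul_inv_cancel_right]⟩
    exact absurd (zpowers_eq_bot.1 (hcore _ hn (zpowers_le.2 hm))) hm1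

/-- For `m ≠ 1` in `M`, the map `a ↦ a(ma⁻¹m⁻¹)` is injective on the finite group `A`, hence onto,
so every `bm` with `b ∈ A` is an `A`-conjugate of `m`. -/
theorem exists_conj_mem_of_not_mem [Finite A] (hM : IsCoatom M) (hMc : IsMulCommutative M)
    (hcore : ∀ K : Subgroup Q, K.Normal → K ≤ M → K = ⊥) [A.Normal] (hA : IsMulCommutative A)
    (hsup : A ⊔ M = ⊤) (hinf : A ⊓ M = ⊥) {g : Q} (hg : g ∉ A) :
    ∃ a : A, (a : Q)⁻¹ * g * a ∈ M := by
  obtain ⟨b, hb, m, hm, rfl⟩ := mem_sup_of_normal_left.1 (hsup ▸ mem_top g)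
  have hm1 : m ≠ 1 := by rintro rfl; exact hg (by simpa using hb)
  have hcomm : ∀ x y : A, (x : Q) * y = y * x := fun x y =>
    congrArg Subtype.val (isMulCommutative_iff.1 hA x y)
  let t : A → A := fun a => ⟨a * (m * (a : Q)⁻¹ * m⁻¹),
    A.mul_mem a.2 (‹A.Normal›.conj_mem _ (A.inv_mem a.2) m)⟩
  have ht : Function.Injective t := by
    intro x y hxy
    have hxy' : (x : Q) * (m * (x : Q)⁻¹ * m⁻¹) = y * (m * (y : Q)⁻¹ * m⁻¹) :=
      congrArg Subtype.val hxy
    have h1 : (y : Q)⁻¹ * x = m * ((y : Q)⁻¹ * x) * m⁻¹ :=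
      calc (y : Q)⁻¹ * x = (y : Q)⁻¹ * (x * (m * (x : Q)⁻¹ * m⁻¹)) * (m * x * m⁻¹) := by group
        _ = m * ((y : Q)⁻¹ * x) * m⁻¹ := by rw [hxy']; group
    have h2 : (y : Q)⁻¹ * x = 1 := eq_one_of_commute_of_coreFree hM hMc hcore hinf hm
      (A.mul_mem (A.inv_mem y.2) x.2) (mul_inv_eq_iff_eq_mul.1 h1.symm).symm hm1
    exact Subtype.ext (inv_mul_eq_one.1 h2).symm
  obtain ⟨a, ha⟩ := Finite.surjective_of_injective ht ⟨b, hb⟩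
  have ha' : (a : Q) * (m * (a : Q)⁻¹ * m⁻¹) = b := congrArg Subtype.val ha
  refine ⟨a, ?_⟩
  rw [← ha']
  convert hm using 1
  group

theorem coveringNumber_le_card_add_one [Finite A] (hM : IsCoatom M) (hMbot : M ≠ ⊥)
    (hMc : IsMulCommutative M) (hcore : ∀ K : Subgroup Q, K.Normal → K ≤ M → K = ⊥) [A.Normal]
    (hA : IsMulCommutative A) (hsup : A ⊔ M = ⊤) (hinf : A ⊓ M = ⊥) :
    coveringNumber Q ≤ (Nat.card A + 1 : ℕ) := by
  let C : A → Subgroup Q := fun a => M.map (MulAut.conj (a : Q)).toMonoidHom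
  refine le_trans (b := (insert A (Set.range C)).encard)
    (sInf_le ⟨_, ?_, fun g => ?_, rfl⟩) ?_
  · rintro H (rfl | ⟨a, rfl⟩) h
    · exact hMbot (by rwa [h, top_inf_eq] at hinf)
    · exact hM.1 (map_injective (MulAut.conj (a : Q)).injective
        (h.trans (map_top_of_surjective _ (MulAut.conj (a : Q)).surjective).symm))
  · by_cases hg : g ∈ A
    · exact ⟨A, Set.mem_insert _ _, hg⟩
    · obtain ⟨a, ha⟩ := exists_conj_mem_of_not_mem hM hMc hcore hA hsup hinf hg
      refine ⟨C a, Set.mem_insert_of_mem _ ⟨a, rfl⟩, _, ha, ?_⟩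
      change (a : Q) * ((a : Q)⁻¹ * g * a) * (a : Q)⁻¹ = g
      group
  · refine (Set.encard_insert_le _ _).trans ?_
    rw [Nat.cast_add, Nat.cast_one]
    refine add_le_add_left ?_ 1
    rw [← Set.image_univ]
    refine (Set.encard_image_le _ _).trans ?_
    rw [Set.encard_univ, ENat.card_eq_coe_natCard]

open scoped IsMulCommutative in
/-- An abelian core-free maximal subgroup with an abelian normal complement is cyclic, since it
embeds into the units of a field of endomorphisms of the complement. -/
theorem isCyclic_of_coreFree [Finite M] (hM : IsCoatom M) (hMc : IsMulCommutative M)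
    (hcore : ∀ K : Subgroup Q, K.Normal → K ≤ M → K = ⊥) [A.Normal] (hA : IsMulCommutative A)
    (hAne : A ≠ ⊥) (hsup : A ⊔ M = ⊤) (hinf : A ⊓ M = ⊥) : IsCyclic M := by
  let f : M →* AddMonoid.End (Additive A) := (monoidEndToAdditive A).toMonoidHom.comp
    ((MulDistribMulAction.toMonoidEnd (MulAut A) A).comp (MulAut.conjNormal.comp M.subtype))
  have hf : ∀ (m : M) (a : A),
      ((f m (Additive.ofMul a)).toMul : Q) = (m : Q) * a * (m : Q)⁻¹ := fun m a => rfl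
  have hcomm : ∀ x ∈ Set.range f, ∀ y ∈ Set.range f, x * y = y * x := by
    rintro _ ⟨x, rfl⟩ _ ⟨y, rfl⟩
    rw [← map_mul, ← map_mul, isMulCommutative_iff.1 hMc]
  let R := Subring.closure (Set.range f)
  have : IsMulCommutative R := Subring.isMulCommutative_closure hcomm
  obtain ⟨a₀, ha₀, ha₀1⟩ := A.bot_or_exists_ne_one.resolve_left hAne
  -- Schur's lemma: the kernel of `s` is `M`-stable, hence normal in `Q`. If nontrivial, it
  -- supplements `M` and so is all of `A`.
  have hker : ∀ s : R, s ≠ 0 → ∀ a : Additive A, (s : AddMonoid.End (Additive A)) a = 0 → a = 0 := by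
    intro s hs a ha
    by_contra ha0
    let sA : A →* A := (monoidEndToAdditive A).symm s
    let K : Subgroup Q := sA.ker.map A.subtype
    have hKn : K.Normal := by
      refine normal_of_le_isMulCommutative hA hsup (map_subtype_le _) ?_
      rintro m hm _ ⟨k, hk, rfl⟩
      let fm : R := ⟨f ⟨m, hm⟩, Subring.subset_closure ⟨_, rfl⟩⟩
      have h1 : (s : AddMonoid.End (Additive A)) (f ⟨m, hm⟩ (Additive.ofMul k)) =
          f ⟨m, hm⟩ ((s : AddMonoid.End (Additive A)) (Additive.ofMul k)) :=
        DFunLike.congr_fun (congrArg Subtype.val (mul_comm s fm)) (Additive.ofMul k)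
      have h2 : (s : AddMonoid.End (Additive A)) (Additive.ofMul k) = 0 := hk
      rw [h2, map_zero] at h1
      exact ⟨(f ⟨m, hm⟩ (Additive.ofMul k)).toMul, h1, rfl⟩
    have hKbot : K ≠ ⊥ := fun e => ha0 <| by
      have h1 : (a.toMul : Q) ∈ K := ⟨a.toMul, ha, rfl⟩
      exact (Subtype.ext (mem_bot.1 (e ▸ h1)) : a.toMul = 1)
    have hKsup := hM.sup_eq_top_of_not_le fun h => hKbot (hcore K hKn h)
    refine hs (Subtype.ext (AddMonoidHom.ext fun b => ?_))
    obtain ⟨_, ⟨k, hk, rfl⟩, m, hm, e⟩ :=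
      mem_sup_of_normal_left.1 (hKsup ▸ mem_top (b.toMul : Q))
    have hmA : m ∈ A := by
      rw [← inv_mul_eq_iff_eq_mul.2 e.symm]
      exact A.mul_mem (A.inv_mem k.2) b.toMul.2
    have hm1 : m = 1 := mem_bot.1 (hinf ▸ ⟨hmA, hm⟩)
    have hkb : k = b.toMul := Subtype.ext (by simpa [hm1] using e)
    rw [hkb] at hk
    exact hk
  have : Nontrivial R := by
    refine ⟨0, 1, fun h => ha₀1 ?_⟩
    have := DFunLike.congr_fun (congrArg Subtype.val h) (Additive.ofMul (⟨a₀, ha₀⟩ : A))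
    exact (congrArg (fun x : Additive A => (x.toMul : Q)) this).symm
  have : NoZeroDivisors R := ⟨fun {r s} h => by
    by_contra! hrs
    refine hrs.2 (Subtype.ext (AddMonoidHom.ext fun a => hker r hrs.1 _ ?_))
    exact DFunLike.congr_fun (congrArg Subtype.val h) a⟩
  have : IsDomain R := NoZeroDivisors.to_isDomain R
  let F : M →* R := f.codRestrict R fun m => Subring.subset_closure ⟨m, rfl⟩
  -- A finite group embedded in the units of a domain is cyclic; fixed-point freeness at `a₀` gives
  -- injectivity.
  refine isCyclic_of_injective_ringHom F ((injective_iff_map_eq_one F).2 fun m hm => ?_)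
  by_contra hm1
  refine ha₀1 (eq_one_of_commute_of_coreFree hM hMc hcore hinf m.2 ha₀ ?_
    fun e => hm1 (Subtype.ext e))
  have := DFunLike.congr_fun (congrArg Subtype.val hm) (Additive.ofMul (⟨a₀, ha₀⟩ : A))
  have h2 : (m : Q) * a₀ * (m : Q)⁻¹ = a₀ := congrArg (fun x : Additive A => (x.toMul : Q)) this
  exact (mul_inv_eq_iff_eq_mul.1 h2).symm

theorem isCyclic_quotient_of_coreFree (hM : IsCoatom M) [IsCyclic M]
    (hcore : ∀ K : Subgroup Q, K.Normal → K ≤ M → K = ⊥) (N : Subgroup Q) [N.Normal]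
    (hN : N ≠ ⊥) : IsCyclic (Q ⧸ N) := by
  have hsup := hM.sup_eq_top_of_not_le fun h => hN (hcore N ‹_› h)
  refine isCyclic_of_surjective ((QuotientGroup.mk' N).comp M.subtype) fun q => ?_
  obtain ⟨x, rfl⟩ := QuotientGroup.mk_surjective q
  obtain ⟨m, hm, k, hk, rfl⟩ :=
    mem_sup_of_normal_right.1 ((sup_comm N M).symm.trans hsup ▸ mem_top x)
  refine ⟨⟨m, hm⟩, ?_⟩
  change (m : Q ⧸ N) = _
  rw [QuotientGroup.eq]
  simpa using hk

end Primitive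

theorem corollary3p1p5 {G : Type*} [Group G] [Finite G] [Group.IsSolvable G]
    (n : ℕ) (hσ : coveringNumber G = n)
    (M : Subgroup G) (hMmax : IsCoatom M) (hMnormal : ¬ M.Normal) (hMcomm : IsMulCommutative M)
    (hMindex : M.index + 1 = n) :
    frattini G ≤ Subgroup.center G ∧
    Nonempty (G ⧸ frattini G ≃*
      innerAut G × (Subgroup.center G ⧸ (frattini G).subgroupOf (Subgroup.center G))) ∧
    IsPrimitiveSumGroup n (innerAut G) := by
  have hΦ : frattini G ≤ Subgroup.center G :=
    hMmax.normal_le_center hMnormal hMcomm (frattini_le_coatom hMmax)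
  obtain ⟨H, hHn, hsup, hinf⟩ := exists_normal_center_sup_eq_top_inf_eq_frattini hΦ
  refine ⟨hΦ, nonempty_quotient_mulEquiv_innerAut_prod hsup hinf, ?_⟩
  let π : G →* innerAut G := (MulAut.conj : G →* MulAut G).rangeRestrict
  have hπ : Function.Surjective π := MonoidHom.rangeRestrict_surjective _
  have hker : π.ker = Subgroup.center G := ker_conj_rangeRestrict
  have hZM := hMmax.center_le hMnormal
  have hcm : (M.map π).comap π = M := Subgroup.comap_map_eq_self (hker.trans_le hZM)
  have hM' : IsCoatom (M.map π) := by
    refine ⟨fun h => hMmax.1 (by rw [← hcm, h, Subgroup.comap_top]), fun L hL => ?_⟩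
    refine Subgroup.comap_injective hπ ?_
    rw [Subgroup.comap_top]
    exact hMmax.2 _ (hcm ▸ (Subgroup.comap_lt_comap_of_surjective hπ).2 hL)
  have hcore : ∀ K : Subgroup (innerAut G), K.Normal → K ≤ M.map π → K = ⊥ := by
    intro K hK hle
    have h1 : K.comap π ≤ M := hcm ▸ Subgroup.comap_mono hle
    have h2 := hMmax.normal_le_center hMnormal hMcomm h1
    refine le_bot_iff.1 ((Subgroup.comap_le_comap_of_surjective hπ).1 ?_)
    rwa [MonoidHom.comap_bot, hker]
  have hbot : M.map π ≠ ⊥ := fun h => hMnormal (by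
    rw [← hcm, h, MonoidHom.comap_bot]; infer_instance)
  have hMc' : IsMulCommutative (M.map π) := inferInstance
  have : Group.IsSolvable (innerAut G) := Group.isSolvable_of_surjective hπ
  have : Nontrivial (innerAut G) := by
    obtain ⟨x, hx⟩ := (M.map π).bot_or_exists_ne_one.resolve_left hbot
    exact ⟨x, 1, hx.2⟩
  have : Finite (innerAut G) := Finite.of_surjective π hπ
  obtain ⟨A, hAn, hAc, hAne⟩ := exists_normal_isMulCommutative_ne_bot (innerAut G)
  obtain ⟨hAsup, hAinf⟩ := sup_eq_top_and_inf_eq_bot_of_coreFree hM' hcore hAc hAne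
  have hcard : Nat.card A + 1 = n := by
    have hcompl : Subgroup.IsComplement' A (M.map π) :=
      Subgroup.isComplement'_of_disjoint_and_mul_eq_univ (disjoint_iff.2 hAinf)
        (by rw [← Subgroup.normal_mul, hAsup, Subgroup.coe_top])
    rw [← hcompl.index_eq_card, ← Subgroup.index_comap_of_surjective _ hπ, hcm, hMindex]
  refine ⟨le_antisymm ?_ (hσ ▸ coveringNumber_le_of_surjective hπ), fun N _ hN => ?_⟩
  · exact hcard ▸ coveringNumber_le_card_add_one hM' hbot hMc' hcore hAc hAsup hAinf
  · have := isCyclic_of_coreFree hM' hMc' hcore hAc hAne hAsup hAinf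
    have := isCyclic_quotient_of_coreFree hM' hcore N hN
    rw [coveringNumber_eq_top_of_isCyclic]
    exact ENat.top_ne_natCast n
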